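/- Let $a,b,c$ also denote the three generators of the Hanoi Towers group $H^{(3)}$, that is, the automorphisms of the rooted ternary tree (vertices: finite words over $\{0,1,2\}$) with self-similar form $$a=(01)(\mathrm{id},\mathrm{id},a),\qquad b=(02)(\mathrm{id},b,\mathrm{id}),\qquad c=(12)(c,\mathrm{id},\mathrm{id}),$$ where $g=\alpha(g_0,g_1,g_2)$ means $g(xw)=\alpha(x)\,g_x(w)$ for each letter $x$ and word $w$. For $n\ge 1$ let $\Sigma_n$ be the Schreier graph of the action on words of length $n$, without its loops: two distinct words $u,v$ of length $n$ are adjacent if and only if $s(u)=v$ for some $s\in\{a,b,c\}$; this $s$ is unique and is the label of the edge. Give each edge with label $a$, $b$, $c$ the weight $a$, $b$, $c$ respectively, where the weights are indeterminates (or elements of any commutative ring, e.g. positive reals). The weight of a spanning subgraph is the product of the weights of its edges, and a weighted generating function is the sum of the weights over all spanning subgraphs of the given kind. Call $0^n$, $1^n$, $2^n$ the leftmost, upmost and rightmost vertex of $\Sigma_n$. Let - $T_n$ be the weighted generating function of the spanning trees of $\Sigma_n$; - $U_n$ (respectively $R_n$, $L_n$) that of the spanning forests of $\Sigma_n$ with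 exactly two components in which the upmost (respectively rightmost, leftmost) vertex lies in one component and the two other outmost vertices both lie in the other component; - $Q_n$ that of the spanning forests of $\Sigma_n$ with exactly three components in which the three outmost vertices lie in three different components. Then for every $n\ge 1$: $$T_{n+1}=T_n^3(ab+ac+bc)+2abc\,T_n^2(U_n+R_n+L_n),$$ $$U_{n+1}=bT_n^3+T_n^2\big((ab+ac+bc)U_n+2b(aR_n+cL_n)\big)+abc\,T_n\big(3R_nL_n+U_n(L_n+R_n+2U_n)\big)+abc\,T_n^2Q_n,$$ $$R_{n+1}=aT_n^3+T_n^2\big((ab+ac+bc)R_n+2a(bU_n+cL_n)\big)+abc\,T_n\big(3U_nL_n+R_n(L_n+U_n+2R_n)\big)+abc\,T_n^2Q_n,$$ $$L_{n+1}=cT_n^3+T_n^2\big((ab+ac+bc)L_n+2c(aR_n+bU_n)\big)+abc\,T_n\big(3R_nU_n+L_n(U_n+R_n+2L_n)\big)+abc\,T_n^2Q_n,$$ $$\begin{aligned}Q_{n+1}={}&4abc\,T_nQ_n(U_n+R_n+L_n)+T_n^2\big((2b+a+c)U_n+(2a+b+c)R_n+(2c+a+b)L_n\big)\\&+T_n^2Q_n(ab+ac+bc)+T_n^3\\&+2abc\big(U_n^2(R_n+L_n)+R_n^2(U_n+L_n)+L_n^2(U_n+R_n)+U_nR_nL_n\big)\\&+2T_n\big(U_nR_n(ac+bc+2ab)+U_nL_n(ab+ac+2bc)+R_nL_n(ab+bc+2ac)\\&\qquad\quad+bU_n^2(a+c)+aR_n^2(b+c)+cL_n^2(a+b)\big),\end{aligned}$$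 and the initial values are $$T_1=ab+ac+bc,\qquad U_1=b,\qquad R_1=a,\qquad L_1=c,\qquad Q_1=1.$$ -/

import Mathlib

namespace Hanoi

/-- The three generators of the Hanoi Towers group on the ternary rooted tree. -/
inductive Gen where
  | a | b | c
  deriving DecidableEq

instance : Fintype Gen where
  elems := {.a, .b, .c}
  complete := by intro s; cases s <;> decide

/-- Words of length `n` over `{0,1,2}`, i.e. the vertices of the `n`-th level of the tree. -/
abbrev Word (n : ℕ) : Type := Fin n → Fin 3

/-- The permutation of the first level induced by a generator:
`(01)` for `a`, `(02)` for `b`, `(12)` for `c`. -/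
def rootPerm : Gen → Equiv.Perm (Fin 3)
  | .a => Equiv.swap 0 1
  | .b => Equiv.swap 0 2
  | .c => Equiv.swap 1 2

/-- The only letter at which the restriction of a generator is the generator itself
(at the two other letters the restriction is the identity). -/
def fixedLetter : Gen → Fin 3
  | .a => 2
  | .b => 1
  | .c => 0

/-- The action of the generators on the `n`-th level, given by the self-similar form
`a = (01)(id,id,a)`, `b = (02)(id,b,id)`, `c = (12)(c,id,id)`; here
`g = α(g₀,g₁,g₂)` acts by `g(xw) = α(x) g_x(w)`. -/
def act (s : Gen) : (n : ℕ) → Word n → Word n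
  | 0, w => w
  | n + 1, w =>
      Fin.cons (rootPerm s (w 0))
        (if w 0 = fixedLetter s then act s n (Fin.tail w) else Fin.tail w)

/-- The generators are involutions. -/
theorem act_act (s : Gen) (n : ℕ) (w : Word n) : act s n (act s n w) = w := by
  induction n with
  | zero => rfl
  | succ n ih =>
    have h1 : ∀ x, rootPerm s (rootPerm s x) = x := by cases s <;> decide
    have h2 : ∀ x, rootPerm s x = fixedLetter s ↔ x = fixedLetter s := by cases s <;> decide
    conv_rhs => rw [← Fin.cons_self_tail w]
    simp only [act, Fin.cons_zero, Fin.tail_cons, h1, h2]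
    split_ifs with h
    · rw [ih]
    · rfl

/-- A vertex moved by two generators to the same place is moved by the same generator:
the Schreier graphs have no multiple edges and the label of a non-loop edge is unique. -/
theorem label_unique (s t : Gen) (n : ℕ) (w : Word n) (hs : act s n w ≠ w)
    (h : act s n w = act t n w) : s = t := by
  induction n with
  | zero => exact absurd rfl hs
  | succ n ih =>
    have h0 : rootPerm s (w 0) = rootPerm t (w 0) := by simpa [act] using congrFun h 0
    by_cases hx : w 0 = fixedLetter s
    · have key : ∀ s t : Gen, rootPerm s (fixedLetter s) = rootPerm t (fixedLetter s) →
          s = t := by decide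
      exact key s t (by rw [← hx]; exact h0)
    · have key : ∀ (s t : Gen) (x : Fin 3), x ≠ fixedLetter s →
          rootPerm s x = rootPerm t x → s = t := by decide
      exact key s t _ hx h0

/-- The `n`-th Schreier graph `Σ_n` of the Hanoi Towers group with respect to the generators
`a, b, c`, without its loops: distinct words `u`, `v` of length `n` are adjacent if and only if
some generator maps `u` to `v`. -/
def schreierGraph (n : ℕ) : SimpleGraph (Word n) where
  Adj u v := u ≠ v ∧ ∃ s : Gen, act s n u = v
  symm := ⟨by
    rintro u v ⟨huv, s, rfl⟩
    exact ⟨huv.symm, s, act_act s n u⟩⟩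
  loopless := ⟨fun _ h => h.1 rfl⟩

/-- The weight attached to a label. -/
def labelWeight {K : Type*} (a b c : K) : Gen → K
  | .a => a
  | .b => b
  | .c => c

open Classical in
/-- The weight of an edge of `Σ_n`: the sum of the weights of the generators that label it.
There is exactly one such label, see `edgeWeight_eq`. -/
noncomputable def edgeWeight {K : Type*} [CommRing K] (a b c : K) (n : ℕ)
    (e : Sym2 (Word n)) : K :=
  ∑ s : Gen with ∃ u : Word n, e = s(u, act s n u), labelWeight a b c s

/-- The edge of `Σ_n` joining `u` to `s(u)`, which is labelled by `s`, has the weight of `s`. -/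
theorem edgeWeight_eq {K : Type*} [CommRing K] (a b c : K) (n : ℕ) (s : Gen) (u : Word n)
    (hs : act s n u ≠ u) :
    edgeWeight a b c n s(u, act s n u) = labelWeight a b c s := by
  classical
  have : (Finset.univ.filter fun t : Gen =>
      ∃ v : Word n, s(u, act s n u) = s(v, act t n v)) = {s} := by
    ext t
    simp only [Finset.mem_filter, Finset.mem_univ, true_and, Finset.mem_singleton]
    constructor
    · rintro ⟨v, hv⟩
      rcases Sym2.eq_iff.1 hv with ⟨h1, h2⟩ | ⟨h1, h2⟩
      · subst h1; exact (label_unique s t n u hs h2).symm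
      · subst h2
        refine (label_unique s t n u hs ?_).symm
        conv_rhs => rw [h1]
        rw [act_act]
    · rintro rfl; exact ⟨u, rfl⟩
  unfold edgeWeight
  rw [← Finset.sum_singleton (labelWeight a b c) s, ← this]

open Classical in
/-- The weighted generating function of the spanning subgraphs `H` of `G` with property `P`:
the sum over all such `H` of the product of the weights of the edges of `H`. A spanning subgraph
of `G` is a graph on the vertex set of `G` all of whose edges are edges of `G`. -/
noncomputable def genFun {V K : Type*} [Fintype V] [CommRing K] (G : SimpleGraph V)
    (w : Sym2 V → K) (P : SimpleGraph V → Prop) : K :=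
  ∑ H : SimpleGraph V with H ≤ G ∧ P H, ∏ e ∈ H.edgeFinset, w e

/-- A `k`-forest: a forest with exactly `k` connected components. -/
def IsForest {V : Type*} (k : ℕ) (H : SimpleGraph V) : Prop :=
  H.IsAcyclic ∧ Nat.card H.ConnectedComponent = k

/-- The leftmost outmost vertex `0ⁿ` of `Σ_n`. -/
def left (n : ℕ) : Word n := fun _ => 0

/-- The upmost outmost vertex `1ⁿ` of `Σ_n`. -/
def up (n : ℕ) : Word n := fun _ => 1

/-- The rightmost outmost vertex `2ⁿ` of `Σ_n`. -/
def right (n : ℕ) : Word n := fun _ => 2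

section GeneratingFunctions

variable {K : Type*} [CommRing K] (a b c : K) (n : ℕ)

/-- `T_n(a,b,c)`: spanning trees of `Σ_n`. -/
noncomputable def genT : K :=
  genFun (schreierGraph n) (edgeWeight a b c n) fun H => H.IsTree

/-- `U_n(a,b,c)`: spanning 2-forests of `Σ_n` with the leftmost and rightmost vertices in the same
component and the upmost vertex in the other component. -/
noncomputable def genU : K :=
  genFun (schreierGraph n) (edgeWeight a b c n) fun H =>
    IsForest 2 H ∧ H.Reachable (left n) (right n) ∧ ¬ H.Reachable (left n) (up n)

/-- `R_n(a,b,c)`: spanning 2-forests of `Σ_n` with the leftmost and upmost vertices in the same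
component and the rightmost vertex in the other component. -/
noncomputable def genR : K :=
  genFun (schreierGraph n) (edgeWeight a b c n) fun H =>
    IsForest 2 H ∧ H.Reachable (left n) (up n) ∧ ¬ H.Reachable (left n) (right n)

/-- `L_n(a,b,c)`: spanning 2-forests of `Σ_n` with the upmost and rightmost vertices in the same
component and the leftmost vertex in the other component. -/
noncomputable def genL : K :=
  genFun (schreierGraph n) (edgeWeight a b c n) fun H =>
    IsForest 2 H ∧ H.Reachable (up n) (right n) ∧ ¬ H.Reachable (up n) (left n)

/-- `Q_n(a,b,c)`: spanning 3-forests of `Σ_n` with the three outmost vertices in three different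
components. -/
noncomputable def genQ : K :=
  genFun (schreierGraph n) (edgeWeight a b c n) fun H =>
    IsForest 3 H ∧ ¬ H.Reachable (left n) (up n) ∧ ¬ H.Reachable (left n) (right n) ∧
      ¬ H.Reachable (up n) (right n)

end GeneratingFunctions

end Hanoi

/-!
Splitting words according to their last letter, `Σ_{n+1}` consists of three copies of `Σ_n` joined
by three edges, one for each generator. Every component of a spanning forest counted by one of the
five generating functions meets an outmost vertex. This property passes from a forest of `Σ_{n+1}`
to its restrictions to the three copies, so each restriction is again counted by one of the five
functions. Conversely, whether three such forests and a set of joining edges form a forest counted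
by a given function depends only on how the forests connect the outmost vertices of their copies.
Hence the five functions at `n + 1` are fixed cubic polynomials in those at `n`, and evaluating
these polynomials is a finite computation. As the recursion also holds for `n = 0`, the initial
values follow from the graph `Σ_0` with a single vertex.
-/

namespace Hanoi

open SimpleGraph

section RootedForest

variable {V ι κ A B : Type*}

theorem reachable_sup_edge_iff {H : SimpleGraph V} {p q u v : V} :
    (H ⊔ edge p q).Reachable u v ↔ H.Reachable u v ∨ (H.Reachable u p ∧ H.Reachable q v) ∨
      (H.Reachable u q ∧ H.Reachable p v) := by
  constructor
  · rintro ⟨w⟩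
    induction w with
    | nil => exact Or.inl (Reachable.refl _)
    | cons hxy _ ih =>
      rw [sup_adj, edge_adj] at hxy
      rcases hxy with hxy | ⟨⟨rfl, rfl⟩ | ⟨rfl, rfl⟩, -⟩
      · have := hxy.reachable
        grind [Reachable.trans]
      all_goals grind [Reachable.refl]
  · have mono {x y : V} : H.Reachable x y → (H ⊔ edge p q).Reachable x y :=
      Reachable.mono le_sup_left
    have hpq : (H ⊔ edge p q).Reachable p q := by
      by_cases h : p = q
      · rw [h]
      · exact Adj.reachable (Or.inr (by simp [edge_adj, h]))
    rintro (h | ⟨hup, hqv⟩ | ⟨huq, hpv⟩)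
    · exact mono h
    · exact (mono hup).trans (hpq.trans (mono hqv))
    · exact (mono huq).trans (hpq.symm.trans (mono hpv))

/-- `H` is a forest, each component of which contains at least one of the terminals `t i`, and two
terminals lie in the same component exactly when they have the same label under `g`. -/
structure IsRootedForest (t : ι → V) (g : ι → A) (H : SimpleGraph V) : Prop where
  isAcyclic : H.IsAcyclic
  exists_reachable (v : V) : ∃ i, H.Reachable v (t i)
  reachable_iff (i j : ι) : H.Reachable (t i) (t j) ↔ g i = g j

theorem isRootedForest_comp_iff {t : ι → V} {g : ι → A} {H : SimpleGraph V} {out : κ → ι}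
    {h : κ → B} (hroot : ∀ v, ∃ i, H.Reachable v (t i))
    (hlabel : ∀ i j, H.Reachable (t i) (t j) ↔ g i = g j) :
    IsRootedForest (t ∘ out) h H ↔
      H.IsAcyclic ∧ (∀ i, ∃ k, g i = g (out k)) ∧
        ∀ j k, g (out j) = g (out k) ↔ h j = h k := by
  simp only [← hlabel]
  refine ⟨fun hH => ⟨hH.isAcyclic, fun i => hH.exists_reachable (t i), hH.reachable_iff⟩,
    fun ⟨hac, hout, hh⟩ => ⟨hac, fun v => ?_, hh⟩⟩
  obtain ⟨i, hi⟩ := hroot v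
  obtain ⟨k, hk⟩ := hout i
  exact ⟨k, hi.trans hk⟩

/-- The graph obtained from `H` by joining the listed pairs of terminals. -/
def addEdges (t : ι → V) (H : SimpleGraph V) : List (ι × ι) → SimpleGraph V
  | [] => H
  | x :: l => addEdges t H l ⊔ edge (t x.1) (t x.2)

/-- The listed pairs of terminals are pairwise distinct potential edges that `H` lacks. -/
structure AreNewEdges (t : ι → V) (H : SimpleGraph V) (l : List (ι × ι)) : Prop where
  ne : ∀ x ∈ l, t x.1 ≠ t x.2
  not_adj : ∀ x ∈ l, ¬ H.Adj (t x.1) (t x.2)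
  pairwise_ne : l.Pairwise fun x y => s(t x.1, t x.2) ≠ s(t y.1, t y.2)

/-- The labels obtained from `g` by identifying the labels of `i` and `j`. -/
def merge [DecidableEq A] (g : ι → A) (i j : ι) : ι → A :=
  fun x => if g x = g i then g j else g x

/-- The labels obtained from `g` by identifying, for each listed pair, the labels of its two
members; it describes the components of a graph after the listed pairs have been joined. -/
def mergeEdges [DecidableEq A] (g : ι → A) : List (ι × ι) → ι → A
  | [] => g
  | x :: l => merge (mergeEdges g l) x.1 x.2

/-- Joining the listed pairs, from the last to the first, always connects two different components,
where `g` labels the components at the start. -/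
def CycleFree [DecidableEq A] (g : ι → A) : List (ι × ι) → Prop
  | [] => True
  | x :: l => CycleFree g l ∧ mergeEdges g l x.1 ≠ mergeEdges g l x.2

instance CycleFree.decidable [DecidableEq A] (g : ι → A) :
    ∀ l : List (ι × ι), Decidable (CycleFree g l)
  | [] => inferInstanceAs (Decidable True)
  | _ :: l =>
    have := decidable g l
    inferInstanceAs (Decidable (_ ∧ _))

variable {t : ι → V} {H : SimpleGraph V} {l : List (ι × ι)}

theorem le_addEdges : H ≤ addEdges t H l := by
  induction l with
  | nil => exact le_rfl
  | cons x l ih => exact ih.trans le_sup_left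

theorem addEdges_adj {u v : V} :
    (addEdges t H l).Adj u v ↔ H.Adj u v ∨ ∃ x ∈ l, (edge (t x.1) (t x.2)).Adj u v := by
  induction l with
  | nil => simp [addEdges]
  | cons x l ih =>
    rw [addEdges, sup_adj, ih, List.exists_mem_cons_iff, or_assoc, or_comm (b := Adj _ u v)]

theorem AreNewEdges.of_cons {x : ι × ι} (h : AreNewEdges t H (x :: l)) : AreNewEdges t H l :=
  ⟨fun y hy => h.ne y (.tail _ hy), fun y hy => h.not_adj y (.tail _ hy), h.pairwise_ne.of_cons⟩

theorem AreNewEdges.not_adj_addEdges {x : ι × ι} (h : AreNewEdges t H (x :: l)) :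
    ¬ (addEdges t H l).Adj (t x.1) (t x.2) := by
  rw [addEdges_adj]
  rintro (hH | ⟨y, hy, hxy⟩)
  · exact h.not_adj x (.head _) hH
  · exact List.rel_of_pairwise_cons h.pairwise_ne hy ((adj_edge _ _).1 hxy).1.symm

theorem exists_reachable_of_addEdges {v : V} (h : ∃ i, (addEdges t H l).Reachable v (t i)) :
    ∃ i, H.Reachable v (t i) := by
  induction l with
  | nil => exact h
  | cons x l ih =>
    obtain ⟨i, hi⟩ := h
    rcases reachable_sup_edge_iff.1 hi with h | ⟨h, -⟩ | ⟨h, -⟩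
    exacts [ih ⟨_, h⟩, ih ⟨_, h⟩, ih ⟨_, h⟩]

variable [DecidableEq A] {g : ι → A}

theorem reachable_addEdges_iff (hg : ∀ i j, H.Reachable (t i) (t j) ↔ g i = g j) (i j : ι) :
    (addEdges t H l).Reachable (t i) (t j) ↔ mergeEdges g l i = mergeEdges g l j := by
  induction l generalizing i j with
  | nil => exact hg i j
  | cons x l ih =>
    simp only [addEdges, reachable_sup_edge_iff, ih, mergeEdges, merge]
    grind

theorem isAcyclic_addEdges_iff (hH : H.IsAcyclic)
    (hg : ∀ i j, H.Reachable (t i) (t j) ↔ g i = g j) (hl : AreNewEdges t H l) :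
    (addEdges t H l).IsAcyclic ↔ CycleFree g l := by
  induction l with
  | nil => exact iff_of_true hH trivial
  | cons x l ih =>
    rw [addEdges, isAcyclic_sup_fromEdgeSet_iff, ih hl.of_cons, reachable_addEdges_iff hg]
    simp only [hl.ne x (.head _), hl.not_adj_addEdges, or_self, imp_false, CycleFree, ne_eq]

theorem IsRootedForest.addEdges_iff {out : κ → ι} {h : κ → B} (hH : IsRootedForest t g H)
    (hl : AreNewEdges t H l) :
    IsRootedForest (t ∘ out) h (addEdges t H l) ↔
      CycleFree g l ∧ (∀ i, ∃ k, mergeEdges g l i = mergeEdges g l (out k)) ∧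
        ∀ j k, mergeEdges g l (out j) = mergeEdges g l (out k) ↔ h j = h k := by
  rw [isRootedForest_comp_iff
      (fun v => (hH.exists_reachable v).imp fun _ => Reachable.mono le_addEdges)
      (reachable_addEdges_iff hH.reachable_iff),
    isAcyclic_addEdges_iff hH.isAcyclic hH.reachable_iff hl]

end RootedForest

section Copies

variable {V W ι κ A : Type*}

/-- The disjoint union of the graphs `H i` on `W`, transported to `V` along `e`. -/
def copies (e : ι × W ≃ V) (H : ι → SimpleGraph W) : SimpleGraph V where
  Adj x y := (e.symm x).1 = (e.symm y).1 ∧ (H (e.symm x).1).Adj (e.symm x).2 (e.symm y).2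
  symm := ⟨fun _ _ h => ⟨h.1.symm, h.1 ▸ h.2.symm⟩⟩
  loopless := ⟨fun _ h => h.2.ne rfl⟩

variable {e : ι × W ≃ V} {G H : ι → SimpleGraph W}

@[simp]
theorem copies_adj {i j : ι} {u v : W} :
    (copies e H).Adj (e (i, u)) (e (j, v)) ↔ i = j ∧ (H i).Adj u v := by
  simp [copies]

theorem copies_le_copies_iff : copies e H ≤ copies e G ↔ ∀ i, H i ≤ G i :=
  ⟨fun h _ _ _ huv => (copies_adj.1 (h (copies_adj.2 ⟨rfl, huv⟩))).2,
    fun h _ _ hxy => ⟨hxy.1, h _ hxy.2⟩⟩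

theorem comap_copies (i : ι) : (copies e H).comap (fun v => e (i, v)) = H i := by
  ext u v
  simp

theorem copies_comap {F : SimpleGraph V} (hF : F ≤ copies e G) :
    copies e (fun i => F.comap fun v => e (i, v)) = F := by
  ext x y
  obtain ⟨⟨i, u⟩, rfl⟩ := e.surjective x
  obtain ⟨⟨j, v⟩, rfl⟩ := e.surjective y
  rw [copies_adj, comap_adj]
  refine ⟨?_, fun h => ?_⟩
  · rintro ⟨rfl, h⟩
    exact h
  · obtain ⟨rfl, -⟩ := copies_adj.1 (hF h)
    exact ⟨rfl, h⟩

theorem comap_le_of_le_copies {F : SimpleGraph V} (hF : F ≤ copies e G) (i : ι) :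
    F.comap (fun v => e (i, v)) ≤ G i :=
  copies_le_copies_iff.1 ((copies_comap hF).trans_le hF) i

theorem copies_reachable_iff {i j : ι} {u v : W} :
    (copies e H).Reachable (e (i, u)) (e (j, v)) ↔ i = j ∧ (H i).Reachable u v := by
  constructor
  · suffices ∀ x y, (copies e H).Reachable x y →
        (e.symm x).1 = (e.symm y).1 ∧
          (H (e.symm x).1).Reachable (e.symm x).2 (e.symm y).2 by
      simpa using this (e (i, u)) (e (j, v))
    rintro x y ⟨w⟩
    induction w with
    | nil => exact ⟨rfl, Reachable.refl _⟩
    | cons h _ ih => exact ⟨h.1.trans ih.1, h.2.reachable.trans (h.1 ▸ ih.2)⟩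
  · rintro ⟨rfl, h⟩
    exact h.map (⟨fun v => e (i, v), fun huv => copies_adj.2 ⟨rfl, huv⟩⟩ : H i →g copies e H)

theorem copies_isAcyclic_iff : (copies e H).IsAcyclic ↔ ∀ i, (H i).IsAcyclic := by
  refine ⟨fun h i => ?_, fun h => ?_⟩
  · exact h.comap ⟨fun v => e (i, v), fun huv => copies_adj.2 ⟨rfl, huv⟩⟩
      (e.injective.comp (Prod.mk_right_injective i))
  · rw [isAcyclic_iff_forall_adj_isBridge]
    intro x y hxy
    obtain ⟨⟨i, u⟩, rfl⟩ := e.surjective x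
    obtain ⟨⟨j, v⟩, rfl⟩ := e.surjective y
    obtain ⟨rfl, huv⟩ := copies_adj.1 hxy
    have hbridge := isAcyclic_iff_forall_adj_isBridge.1 (h i) huv
    rw [isBridge_iff] at hbridge ⊢
    have hcomap : ((copies e H).deleteEdges {s(e (i, u), e (i, v))}).comap
        (fun v => e (i, v)) = (H i).deleteEdges {s(u, v)} := by
      ext
      simp
    rwa [← copies_comap (deleteEdges_le (G := copies e H) {s(e (i, u), e (i, v))}),
      copies_reachable_iff, hcomap, and_iff_right rfl]

theorem isRootedForest_copies {t : κ → W} {g : ι → κ → A}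
    (h : ∀ i, IsRootedForest t (g i) (H i)) :
    IsRootedForest (fun x : ι × κ => e (x.1, t x.2)) (fun x => (x.1, g x.1 x.2))
      (copies e H) where
  isAcyclic := copies_isAcyclic_iff.2 fun i => (h i).isAcyclic
  exists_reachable v := by
    obtain ⟨⟨i, u⟩, rfl⟩ := e.surjective v
    obtain ⟨k, hk⟩ := (h i).exists_reachable u
    exact ⟨(i, k), copies_reachable_iff.2 ⟨rfl, hk⟩⟩
  reachable_iff := by
    rintro ⟨i, j⟩ ⟨i', k⟩
    rw [copies_reachable_iff, Prod.mk.injEq]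
    refine and_congr_right ?_
    rintro rfl
    exact (h i).reachable_iff j k

theorem exists_reachable_of_copies {t : κ → W}
    (h : ∀ v, ∃ x : ι × κ, (copies e H).Reachable v (e (x.1, t x.2))) (i : ι) (v : W) :
    ∃ k, (H i).Reachable v (t k) := by
  obtain ⟨⟨j, k⟩, hk⟩ := h (e (i, v))
  obtain ⟨rfl, hk⟩ := copies_reachable_iff.1 hk
  exact ⟨k, hk⟩

open Classical in
theorem prod_edgeFinset_copies {K : Type*} [CommMonoid K] [Fintype ι] [Fintype V] [Fintype W]
    (w : Sym2 V → K) :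
    ∏ x ∈ (copies e H).edgeFinset, w x =
      ∏ i, ∏ x ∈ (H i).edgeFinset, w (x.map fun v => e (i, v)) := by
  rw [Finset.prod_sigma']
  symm
  refine Finset.prod_bij (fun x _ => x.2.map fun v => e (x.1, v)) ?_ ?_ ?_ fun _ _ => rfl
  · rintro ⟨i, x⟩ hx
    induction x with
    | h u v => simpa using hx
  · rintro ⟨i, x⟩ - ⟨j, y⟩ - h
    induction x with
    | h u v =>
      induction y with
      | h u' v' =>
        simp only [Sym2.map_mk, Sym2.eq_iff, EmbeddingLike.apply_eq_iff_eq, Prod.mk.injEq] at h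
        obtain rfl : i = j := by rcases h with h | h <;> exact h.1.1
        simpa using h
  · intro x hx
    induction x with
    | h x y =>
      obtain ⟨⟨i, u⟩, rfl⟩ := e.surjective x
      obtain ⟨⟨j, v⟩, rfl⟩ := e.surjective y
      rw [mem_edgeFinset, mem_edgeSet, copies_adj] at hx
      obtain ⟨rfl, h⟩ := hx
      exact ⟨⟨i, s(u, v)⟩, by simpa using h, rfl⟩

end Copies

section GenFun

theorem le_sup_edge_iff_le {V : Type*} {G H : SimpleGraph V} {p q : V} (h : ¬ H.Adj p q) :
    H ≤ G ⊔ edge p q ↔ H ≤ G := by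
  rw [← sdiff_le_iff', sdiff_edge _ h]

variable {V W ι τ K : Type*} [CommRing K] [Fintype V] {G : SimpleGraph V} {w : Sym2 V → K}
  {P : SimpleGraph V → Prop}

open Classical in
theorem genFun_congr {w' : Sym2 V → K} {P' : SimpleGraph V → Prop}
    (hw : ∀ x ∈ G.edgeSet, w x = w' x) (hP : ∀ H ≤ G, P H ↔ P' H) :
    genFun G w P = genFun G w' P' := by
  refine Finset.sum_congr (Finset.filter_congr fun H _ => and_congr_right (hP H))
    fun H hH => Finset.prod_congr rfl fun x hx => hw x ?_
  exact edgeSet_mono (Finset.mem_filter.1 hH).2.1 (mem_edgeFinset.1 hx)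

open Classical in
theorem genFun_exists [Fintype τ] {O : τ → Prop} {F : τ → SimpleGraph V → Prop}
    (hF : ∀ H p q, F p H → F q H → p = q) :
    genFun G w (fun H => ∃ p, O p ∧ F p H) = ∑ p with O p, genFun G w (F p) := by
  simp only [genFun]
  rw [← Finset.sum_biUnion]
  · refine Finset.sum_congr ?_ fun _ _ => rfl
    ext H
    simp only [Finset.mem_filter, Finset.mem_univ, Finset.mem_biUnion, true_and]
    tauto
  · refine fun p _ q _ hpq => Finset.disjoint_left.2 fun H hp hq => hpq ?_
    exact hF H p q (Finset.mem_filter.1 hp).2.2 (Finset.mem_filter.1 hq).2.2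

open Classical in
theorem genFun_sup_edge {p q : V} (hpq : p ≠ q) (hG : ¬ G.Adj p q) :
    genFun (G ⊔ edge p q) w P =
      genFun G w P + w s(p, q) * genFun G w fun H => P (H ⊔ edge p q) := by
  unfold genFun
  rw [← Finset.sum_filter_not_add_sum_filter _ (fun H : SimpleGraph V => H.Adj p q)]
  congr 1
  · refine Finset.sum_congr ?_ fun _ _ => rfl
    ext H
    simp only [Finset.mem_filter, Finset.mem_univ, true_and]
    have hnot : H ≤ G → ¬ H.Adj p q := fun h h' => hG (h h')
    have hle := le_sup_edge_iff_le (G := G) (H := H) (p := p) (q := q)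
    tauto
  · rw [Finset.mul_sum]
    symm
    refine Finset.sum_nbij' (· ⊔ edge p q) (· \ edge p q) ?_ ?_ ?_ ?_ ?_
    all_goals
      intro H hH
      simp only [Finset.mem_filter, Finset.mem_univ, true_and] at hH ⊢
    · exact ⟨⟨sup_le_sup_right hH.1 _, hH.2⟩, Or.inr (by simp [edge_adj, hpq])⟩
    · rw [sdiff_le_iff', sdiff_sup_cancel ((edge_le_iff _).2 (.inr hH.2))]
      exact hH.1
    · rw [sup_sdiff_right_self, sdiff_edge _ fun h => hG (hH.1 h)]
    · exact sdiff_sup_cancel ((edge_le_iff _).2 (.inr hH.2))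
    · rw [← Finset.prod_cons (by simpa using fun h => hG (hH.1 h)),
        ← edgeFinset_sup_edge _ (fun h => hG (hH.1 h)) hpq]
      congr!

theorem genFun_addEdges {t : ι → V} {l : List (ι × ι)} (hl : AreNewEdges t G l) :
    genFun (addEdges t G l) w P =
      (l.sublists'.map fun S => (S.map fun x => w s(t x.1, t x.2)).prod *
        genFun G w fun H => P (addEdges t H S)).sum := by
  induction l generalizing P with
  | nil => simp [addEdges]
  | cons x l ih =>
    rw [addEdges, genFun_sup_edge (hl.ne x (.head _)) hl.not_adj_addEdges, ih hl.of_cons,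
      ih hl.of_cons, List.sublists'_cons, List.map_append, List.sum_append, List.map_map,
      ← List.sum_map_mul_left]
    simp only [Function.comp_def, List.map_cons, List.prod_cons, mul_assoc, addEdges]

open Classical in
theorem genFun_copies [Fintype ι] [Fintype W] {e : ι × W ≃ V} {G : ι → SimpleGraph W}
    {P : ι → SimpleGraph W → Prop} :
    genFun (copies e G) w (fun H => ∀ i, P i (H.comap fun v => e (i, v))) =
      ∏ i, genFun (G i) (fun x => w (x.map fun v => e (i, v))) (P i) := by
  simp only [genFun, Finset.prod_univ_sum]
  symm
  refine Finset.sum_nbij' (copies e) (fun H i => H.comap fun v => e (i, v)) ?_ ?_ ?_ ?_ ?_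
  all_goals
    intro H hH
    simp only [Fintype.mem_piFinset, Finset.mem_filter, Finset.mem_univ, true_and] at hH ⊢
  · simpa only [copies_le_copies_iff, comap_copies, ← forall_and] using hH
  · exact fun i => ⟨comap_le_of_le_copies hH.1 i, hH.2 i⟩
  · exact funext fun i => comap_copies i
  · exact copies_comap hH.1
  · exact prod_edgeFinset_copies w |>.symm

end GenFun

section Patterns

variable {V ι A : Type*}

theorem isRootedForest_iff_isForest [Finite V] {t : ι → V} {g : ι → A} {H : SimpleGraph V} :
    IsRootedForest t g H ↔ IsForest (Nat.card (Set.range g)) H ∧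
      ∀ i j, H.Reachable (t i) (t j) ↔ g i = g j := by
  set f : ι → H.ConnectedComponent := fun i => H.connectedComponentMk (t i) with hf
  have hroot : (∀ v, ∃ i, H.Reachable v (t i)) ↔ Set.range f = Set.univ := by
    rw [Set.eq_univ_iff_forall, ConnectedComponent.forall]
    simp only [hf, Set.mem_range, ConnectedComponent.eq, reachable_comm]
  have hcard (hg : ∀ i j, H.Reachable (t i) (t j) ↔ g i = g j) :
      Nat.card (Set.range g) = Nat.card (Set.range f) := by
    have hker : Setoid.ker g = Setoid.ker f := by
      ext i j
      rw [Setoid.ker_def, Setoid.ker_def, ← hg i j, ConnectedComponent.eq]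
    rw [← Nat.card_congr (Setoid.quotientKerEquivRange g),
      ← Nat.card_congr (Setoid.quotientKerEquivRange f), hker]
  constructor
  · rintro ⟨hac, hH, hg⟩
    refine ⟨⟨hac, ?_⟩, hg⟩
    rw [hcard hg, hroot.1 hH, Nat.card_coe_set_eq, Set.ncard_univ]
  · rintro ⟨⟨hac, hH⟩, hg⟩
    refine ⟨hac, hroot.2 ?_, hg⟩
    rw [Set.eq_univ_iff_ncard, hH, hcard hg, Nat.card_coe_set_eq]

/-- The ways in which a spanning forest can connect the three outmost vertices: all of them, all
but the one fixed by the generator `s`, or none. -/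
inductive Pattern where
  | tree
  | isolated (s : Gen)
  | sep
  deriving DecidableEq, Fintype

/-- A labelling of the outmost vertices in which two of them have the same label exactly if they are
connected. -/
def Pattern.rep : Pattern → Fin 3 → Fin 3
  | .tree => 0
  | .isolated s => Pi.single (fixedLetter s) 1
  | .sep => id

theorem Pattern.forall_rep_eq_iff {p : Pattern} : (∀ i j, p.rep i = p.rep j) ↔ p = .tree := by
  decide +revert

theorem Pattern.eq_of_isRootedForest {t : Fin 3 → V} {H : SimpleGraph V} {p q : Pattern}
    (hp : IsRootedForest t p.rep H) (hq : IsRootedForest t q.rep H) : p = q := by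
  have rep_separates : ∀ p q : Pattern,
      (∀ i j, p.rep i = p.rep j ↔ q.rep i = q.rep j) → p = q := by decide
  exact rep_separates p q fun i j => (hp.reachable_iff i j).symm.trans (hq.reachable_iff i j)

theorem Pattern.exists_rep_eq_iff (r : Setoid (Fin 3)) :
    ∃ p : Pattern, ∀ i j, r i j ↔ p.rep i = p.rep j := by
  have exists_rep : ∀ f : Fin 3 → Fin 3, ∃ p : Pattern, ∀ i j, f i = f j ↔ p.rep i = p.rep j := by
    decide
  simpa only [Quotient.out_inj, Quotient.eq] using exists_rep fun i => (Quotient.mk r i).out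

theorem Pattern.exists_isRootedForest {t : Fin 3 → V} {H : SimpleGraph V} (hac : H.IsAcyclic)
    (hroot : ∀ v, ∃ i, H.Reachable v (t i)) : ∃ p : Pattern, IsRootedForest t p.rep H :=
  (exists_rep_eq_iff (H.reachableSetoid.comap t)).imp fun _ hp => ⟨hac, hroot, hp⟩

theorem isRootedForest_tree_iff {t : Fin 3 → V} {H : SimpleGraph V} :
    IsRootedForest t Pattern.tree.rep H ↔ H.IsTree := by
  constructor
  · rintro ⟨hac, hroot, hr⟩
    have : Nonempty V := ⟨t 0⟩
    refine ⟨⟨fun u v => ?_⟩, hac⟩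
    obtain ⟨i, hi⟩ := hroot u
    obtain ⟨j, hj⟩ := hroot v
    exact hi.trans (((hr i j).2 rfl).trans hj.symm)
  · exact fun h => ⟨h.isAcyclic, fun v => ⟨0, h.connected v _⟩,
      fun i j => iff_of_true (h.connected _ _) rfl⟩

theorem isRootedForest_isolated_iff [Finite V] {t : Fin 3 → V} {H : SimpleGraph V} {s : Gen}
    {j k : Fin 3} (hj : j ≠ fixedLetter s) (hk : k ≠ fixedLetter s) (hjk : j ≠ k) :
    IsRootedForest t (Pattern.isolated s).rep H ↔
      IsForest 2 H ∧ H.Reachable (t j) (t k) ∧ ¬ H.Reachable (t j) (t (fixedLetter s)) := by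
  have hrep (x y : Fin 3) : (Pattern.isolated s).rep x = (Pattern.isolated s).rep y ↔
      (x = fixedLetter s ↔ y = fixedLetter s) := by
    decide +revert
  have hcard : Nat.card (Set.range (Pattern.isolated s).rep) = 2 := by
    rw [Nat.card_eq_fintype_card]
    cases s <;> decide
  have hcover (x : Fin 3) : x = fixedLetter s ∨ x = j ∨ x = k := by
    grind
  rw [isRootedForest_iff_isForest, hcard]
  refine and_congr_right fun _ => ⟨fun h => by simp [h, hrep, hj, hk], fun ⟨hr, hn⟩ x y => ?_⟩
  rw [hrep]
  rcases hcover x with rfl | rfl | rfl <;> rcases hcover y with rfl | rfl | rfl <;>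
    grind [Reachable.refl, Reachable.symm, Reachable.trans]

theorem isRootedForest_sep_iff [Finite V] {t : Fin 3 → V} {H : SimpleGraph V} :
    IsRootedForest t Pattern.sep.rep H ↔
      IsForest 3 H ∧ ¬ H.Reachable (t 0) (t 1) ∧ ¬ H.Reachable (t 0) (t 2) ∧
        ¬ H.Reachable (t 1) (t 2) := by
  have hcard : Nat.card (Set.range Pattern.sep.rep) = 3 := by
    rw [Nat.card_eq_fintype_card]
    decide
  rw [isRootedForest_iff_isForest, hcard]
  refine and_congr_right fun _ =>
    ⟨fun h => by simp [h, Pattern.rep], fun ⟨h01, h02, h12⟩ x y => ?_⟩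
  fin_cases x <;> fin_cases y <;>
    simp [Pattern.rep, h01, h02, h12, reachable_comm (u := t 1) (v := t 0),
      reachable_comm (u := t 2)]

end Patterns

/-- The outmost vertex `jⁿ` of `Σ_n`. -/
def corner (n : ℕ) (j : Fin 3) : Word n := fun _ => j

section GenPattern

variable {K : Type*} [CommRing K] (a b c : K) (n : ℕ)

/-- The weighted generating function of the spanning forests of `Σ_n` with a given pattern. -/
noncomputable def genPattern (p : Pattern) : K :=
  genFun (schreierGraph n) (edgeWeight a b c n) (IsRootedForest (corner n) p.rep)

theorem genT_eq_genPattern : genT a b c n = genPattern a b c n .tree :=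
  genFun_congr (fun _ _ => rfl) fun _ _ => isRootedForest_tree_iff.symm

theorem genU_eq_genPattern : genU a b c n = genPattern a b c n (.isolated .b) :=
  genFun_congr (fun _ _ => rfl) fun _ _ =>
    (isRootedForest_isolated_iff (t := corner n) (s := .b) (j := 0) (k := 2)
      (by decide) (by decide) (by decide)).symm

theorem genR_eq_genPattern : genR a b c n = genPattern a b c n (.isolated .a) :=
  genFun_congr (fun _ _ => rfl) fun _ _ =>
    (isRootedForest_isolated_iff (t := corner n) (s := .a) (j := 0) (k := 1)
      (by decide) (by decide) (by decide)).symm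

theorem genL_eq_genPattern : genL a b c n = genPattern a b c n (.isolated .c) :=
  genFun_congr (fun _ _ => rfl) fun _ _ =>
    (isRootedForest_isolated_iff (t := corner n) (s := .c) (j := 1) (k := 2)
      (by decide) (by decide) (by decide)).symm

theorem genQ_eq_genPattern : genQ a b c n = genPattern a b c n .sep :=
  genFun_congr (fun _ _ => rfl) fun _ _ => (isRootedForest_sep_iff (t := corner n)).symm

end GenPattern

section SelfSimilarity

theorem rootPerm_fixedLetter (s : Gen) : rootPerm s (fixedLetter s) = fixedLetter s := by
  decide +revert

theorem act_cons (s : Gen) (n : ℕ) (x : Fin 3) (w : Word n) :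
    act s (n + 1) (Fin.cons x w : Word (n + 1)) =
      (Fin.cons (rootPerm s x) (if x = fixedLetter s then act s n w else w) : Word (n + 1)) := by
  simp only [act, Fin.cons_zero, Fin.tail_cons]

theorem cons_corner (n : ℕ) (j : Fin 3) :
    (Fin.cons j (corner n j) : Word (n + 1)) = corner (n + 1) j := by
  funext i
  cases i using Fin.cases <;> rfl

/-- Words of length `n + 1`, split into the last letter and the word before it. -/
def snoc (n : ℕ) : Fin 3 × Word n ≃ Word (n + 1) := Fin.snocEquiv fun _ => Fin 3

theorem snoc_inj {n : ℕ} {i j : Fin 3} {u v : Word n} :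
    snoc n (i, u) = snoc n (j, v) ↔ i = j ∧ u = v := by
  rw [(snoc n).injective.eq_iff, Prod.mk.injEq]

theorem snoc_cons (n : ℕ) (i x : Fin 3) (w : Word n) :
    snoc (n + 1) (i, (Fin.cons x w : Word (n + 1))) =
      (Fin.cons x (snoc n (i, w)) : Word (n + 2)) :=
  (Fin.cons_snoc_eq_snoc_cons (β := Fin 3) x w i).symm

theorem snoc_corner (n : ℕ) (j : Fin 3) : snoc n (j, corner n j) = corner (n + 1) j := by
  induction n with
  | zero => funext i; rfl
  | succ n ih => rw [← cons_corner, snoc_cons, ih, cons_corner]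

theorem act_snoc (s : Gen) (n : ℕ) (i : Fin 3) (w : Word n) :
    act s (n + 1) (snoc n (i, w)) =
      if w = corner n (fixedLetter s) then snoc n (rootPerm s i, w)
      else snoc n (i, act s n w) := by
  induction n with
  | zero =>
    rw [if_pos (Subsingleton.elim _ _)]
    funext k
    obtain rfl : k = 0 := Fin.fin_one_eq_zero k
    rfl
  | succ n ih =>
    obtain ⟨x, v, rfl⟩ : ∃ x v, w = (Fin.cons x v : Word (n + 1)) :=
      ⟨_, _, (Fin.cons_self_tail w).symm⟩
    simp only [snoc_cons, act_cons, ← cons_corner, Fin.cons_inj, ih]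
    by_cases hx : x = fixedLetter s
    · subst hx
      simp only [if_true, true_and]
      split_ifs
      · rw [rootPerm_fixedLetter]
      · rfl
    · simp only [hx, if_false, false_and]

theorem act_snoc_of_ne {s : Gen} {n : ℕ} {w : Word n} (hw : act s n w ≠ w) (i : Fin 3) :
    act s (n + 1) (snoc n (i, w)) = snoc n (i, act s n w) := by
  rw [act_snoc, if_neg]
  rintro rfl
  refine hw ?_
  cases n with
  | zero => rfl
  | succ n => rw [← snoc_corner, act_snoc, if_pos rfl, rootPerm_fixedLetter]

/-- The vertex of `Σ_{n+1}` that is the outmost vertex `x.2` of the copy of `Σ_n` formed by the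
words with last letter `x.1`. -/
def innerCorner (n : ℕ) (x : Fin 3 × Fin 3) : Word (n + 1) := snoc n (x.1, corner n x.2)

/-- The ends of the edge with label `s` between two of the three copies of `Σ_n` in `Σ_{n+1}`; a
pair `(i, j)` stands for `innerCorner n (i, j)`. -/
def bridge (s : Gen) : (Fin 3 × Fin 3) × (Fin 3 × Fin 3) :=
  ((fixedLetter s + 1, fixedLetter s), (fixedLetter s + 2, fixedLetter s))

theorem bridge_copy_ne (s : Gen) : (bridge s).1.1 ≠ (bridge s).2.1 := by
  decide +revert

theorem innerCorner_bridge_ne (n : ℕ) (s : Gen) :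
    innerCorner n (bridge s).1 ≠ innerCorner n (bridge s).2 :=
  fun h => bridge_copy_ne s (snoc_inj.1 h).1

theorem act_innerCorner_bridge (n : ℕ) (s : Gen) :
    act s (n + 1) (innerCorner n (bridge s).1) = innerCorner n (bridge s).2 := by
  have hroot : rootPerm s (fixedLetter s + 1) = fixedLetter s + 2 := by decide +revert
  rw [innerCorner, act_snoc, bridge, if_pos rfl, hroot, innerCorner]

theorem edge_bridge_adj {n : ℕ} {s : Gen} {i j : Fin 3} {u v : Word n} :
    (edge (innerCorner n (bridge s).1) (innerCorner n (bridge s).2)).Adj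
        (snoc n (i, u)) (snoc n (j, v)) ↔
      u = corner n (fixedLetter s) ∧ v = corner n (fixedLetter s) ∧ i ≠ j ∧ rootPerm s i = j := by
  have hroot : (i = fixedLetter s + 1 ∧ j = fixedLetter s + 2 ∨
      i = fixedLetter s + 2 ∧ j = fixedLetter s + 1) ↔ i ≠ j ∧ rootPerm s i = j := by
    decide +revert
  rw [← hroot]
  have hne := innerCorner_bridge_ne n s
  simp only [edge_adj, innerCorner, bridge, snoc_inj, ne_eq] at hne ⊢
  grind

theorem schreierGraph_succ_adj {n : ℕ} {i j : Fin 3} {u v : Word n} :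
    (schreierGraph (n + 1)).Adj (snoc n (i, u)) (snoc n (j, v)) ↔
      i = j ∧ (schreierGraph n).Adj u v ∨
        ∃ s, u = corner n (fixedLetter s) ∧ v = corner n (fixedLetter s) ∧ i ≠ j ∧
          rootPerm s i = j := by
  constructor
  · rintro ⟨hne, s, hs⟩
    rw [act_snoc] at hs
    split_ifs at hs with hu
    · obtain ⟨rfl, rfl⟩ := snoc_inj.1 hs
      exact .inr ⟨s, hu, hu, fun h => hne (snoc_inj.2 ⟨h, rfl⟩), rfl⟩
    · obtain ⟨rfl, rfl⟩ := snoc_inj.1 hs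
      exact .inl ⟨rfl, fun h => hne (snoc_inj.2 ⟨rfl, h⟩), s, rfl⟩
  · rintro (⟨rfl, hne, s, rfl⟩ | ⟨s, rfl, rfl, hij, rfl⟩)
    · exact ⟨fun h => hne (snoc_inj.1 h).2, s, act_snoc_of_ne hne.symm i⟩
    · exact ⟨fun h => hij (snoc_inj.1 h).1, s, by rw [act_snoc, if_pos rfl]⟩

theorem schreierGraph_succ (n : ℕ) :
    schreierGraph (n + 1) = addEdges (innerCorner n) (copies (snoc n) fun _ => schreierGraph n)
      ([.a, .b, .c].map bridge) := by
  have mem_gens : ∀ s, s ∈ [Gen.a, .b, .c] := by decide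
  ext x y
  obtain ⟨⟨i, u⟩, rfl⟩ := (snoc n).surjective x
  obtain ⟨⟨j, v⟩, rfl⟩ := (snoc n).surjective y
  rw [schreierGraph_succ_adj, addEdges_adj, copies_adj]
  simp only [List.mem_map, mem_gens, true_and, exists_exists_eq_and, edge_bridge_adj]

theorem areNewEdges_bridge (n : ℕ) (H : Fin 3 → SimpleGraph (Word n)) {S : List Gen}
    (hS : S.Nodup) : AreNewEdges (innerCorner n) (copies (snoc n) H) (S.map bridge) where
  ne := List.forall_mem_map.2 fun s _ => innerCorner_bridge_ne n s
  not_adj := List.forall_mem_map.2 fun s _ h => bridge_copy_ne s (copies_adj.1 h).1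
  pairwise_ne := List.pairwise_map.2 <| hS.imp fun hne h => by
    have copies_determine_gen : ∀ s r, s((bridge s).1.1, (bridge s).2.1) =
        s((bridge r).1.1, (bridge r).2.1) → s = r := by decide
    have hcopy := congrArg (Sym2.map fun w => ((snoc n).symm w).1) h
    simp only [Sym2.map_mk, innerCorner, Equiv.symm_apply_apply] at hcopy
    exact hne (copies_determine_gen _ _ hcopy)

variable {K : Type*} [CommRing K] (a b c : K)

theorem edgeWeight_bridge (n : ℕ) (s : Gen) :
    edgeWeight a b c (n + 1) s(innerCorner n (bridge s).1, innerCorner n (bridge s).2) =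
      labelWeight a b c s := by
  rw [← act_innerCorner_bridge]
  refine edgeWeight_eq a b c _ s _ ?_
  rw [act_innerCorner_bridge]
  exact (innerCorner_bridge_ne n s).symm

theorem edgeWeight_snoc (n : ℕ) (i : Fin 3) {x : Sym2 (Word n)}
    (hx : x ∈ (schreierGraph n).edgeSet) :
    edgeWeight a b c (n + 1) (x.map fun v => snoc n (i, v)) = edgeWeight a b c n x := by
  induction x with
  | h u v =>
    obtain ⟨hne, s, rfl⟩ : u ≠ v ∧ ∃ s, act s n u = v := hx
    rw [edgeWeight_eq a b c n s u hne.symm, Sym2.map_mk, ← act_snoc_of_ne hne.symm]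
    refine edgeWeight_eq a b c _ s _ ?_
    rw [act_snoc_of_ne hne.symm]
    exact fun h => hne (snoc_inj.1 h).2.symm

end SelfSimilarity

section Transfer

/-- The three copies of `Σ_n` in `Σ_{n+1}`, carrying spanning forests with the patterns `p i` and
joined by the bridges with labels in `S`, form a spanning forest with pattern `q`. This is phrased
through labels of the components at the nine outmost vertices of the copies, which makes it
decidable. -/
def Joins (q : Pattern) (S : List Gen) (p : Fin 3 → Pattern) : Prop :=
  let g : Fin 3 × Fin 3 → Fin 3 × Fin 3 := fun x => (x.1, (p x.1).rep x.2)
  let g' := mergeEdges g (S.map bridge)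
  CycleFree g (S.map bridge) ∧ (∀ x, ∃ k, g' x = g' (k, k)) ∧
    ∀ j k, g' (j, j) = g' (k, k) ↔ q.rep j = q.rep k

instance Joins.decidable (q : Pattern) (S : List Gen) (p : Fin 3 → Pattern) :
    Decidable (Joins q S p) :=
  inferInstanceAs (Decidable (_ ∧ _ ∧ _))

theorem corner_succ_eq_innerCorner (n : ℕ) :
    corner (n + 1) = innerCorner n ∘ fun k => (k, k) :=
  funext fun k => (snoc_corner n k).symm

theorem isRootedForest_addEdges_copies_iff {n : ℕ} {q : Pattern} {S : List Gen} (hS : S.Nodup)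
    {H : Fin 3 → SimpleGraph (Word n)} :
    IsRootedForest (corner (n + 1)) q.rep
        (addEdges (innerCorner n) (copies (snoc n) H) (S.map bridge)) ↔
      ∃ p, Joins q S p ∧ ∀ i, IsRootedForest (corner n) (p i).rep (H i) := by
  have joins_iff {p : Fin 3 → Pattern} (hp : ∀ i, IsRootedForest (corner n) (p i).rep (H i)) :
      IsRootedForest (corner (n + 1)) q.rep
        (addEdges (innerCorner n) (copies (snoc n) H) (S.map bridge)) ↔ Joins q S p := by
    rw [corner_succ_eq_innerCorner]
    exact (isRootedForest_copies hp).addEdges_iff (areNewEdges_bridge n H hS)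
  refine ⟨fun h => ?_, fun ⟨p, hjoins, hp⟩ => (joins_iff hp).2 hjoins⟩
  have hac := copies_isAcyclic_iff.1 (h.isAcyclic.anti le_addEdges)
  have hroot := exists_reachable_of_copies (e := snoc n) (H := H) (t := corner n) fun v => by
    obtain ⟨k, hk⟩ := h.exists_reachable v
    rw [corner_succ_eq_innerCorner] at hk
    exact exists_reachable_of_addEdges ⟨_, hk⟩
  choose p hp using fun i => Pattern.exists_isRootedForest (hac i) (hroot i)
  exact ⟨p, (joins_iff hp).1 h, hp⟩

variable {K : Type*} [CommRing K]

/-- One step of the recursion of the generating functions: the sum over the sets `S` of bridges that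
are present and the patterns `p` on the three copies which they join to the pattern `q`. -/
def transfer (w : Gen → K) (F : Pattern → K) (q : Pattern) : K :=
  ([.a, .b, .c].sublists'.map fun S => (S.map w).prod * ∑ p with Joins q S p, ∏ i, F (p i)).sum

variable (a b c : K) (n : ℕ) (q : Pattern)

theorem genFun_copies_schreierGraph {S : List Gen} (hS : S.Nodup) :
    (genFun (copies (snoc n) fun _ => schreierGraph n) (edgeWeight a b c (n + 1)) fun H =>
        IsRootedForest (corner (n + 1)) q.rep (addEdges (innerCorner n) H (S.map bridge))) =
      ∑ p with Joins q S p, ∏ i, genPattern a b c n (p i) := by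
  classical
  calc
    _ = genFun (copies (snoc n) fun _ => schreierGraph n) (edgeWeight a b c (n + 1)) fun H =>
          ∃ p, Joins q S p ∧ ∀ i, IsRootedForest (corner n) (p i).rep
            (H.comap fun v => snoc n (i, v)) :=
      genFun_congr (fun _ _ => rfl) fun H hH => by
        rw [← isRootedForest_addEdges_copies_iff hS, copies_comap hH]
    _ = ∑ p with Joins q S p, genFun (copies (snoc n) fun _ => schreierGraph n)
          (edgeWeight a b c (n + 1)) fun H =>
            ∀ i, IsRootedForest (corner n) (p i).rep (H.comap fun v => snoc n (i, v)) := by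
      rw [genFun_exists fun H p p' hp hp' =>
        funext fun i => Pattern.eq_of_isRootedForest (hp i) (hp' i)]
      congr!
    _ = ∑ p with Joins q S p, ∏ i, genPattern a b c n (p i) := by
      refine Finset.sum_congr rfl fun p _ => ?_
      rw [genFun_copies (P := fun i => IsRootedForest (corner n) (p i).rep)]
      exact Finset.prod_congr rfl fun i _ =>
        genFun_congr (fun _ => edgeWeight_snoc a b c n i) fun _ _ => Iff.rfl

theorem genPattern_succ :
    genPattern a b c (n + 1) q = transfer (labelWeight a b c) (genPattern a b c n) q := by
  have hnodup : [Gen.a, .b, .c].Nodup := by decide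
  rw [genPattern, schreierGraph_succ, genFun_addEdges (areNewEdges_bridge n _ hnodup),
    List.sublists'_map, List.map_map, transfer]
  refine congrArg List.sum (List.map_congr_left fun S hS => ?_)
  rw [Function.comp_apply, List.map_map,
    genFun_copies_schreierGraph a b c n q (hnodup.sublist (List.mem_sublists'.1 hS))]
  simp only [Function.comp_def, edgeWeight_bridge]

theorem genPattern_zero : genPattern a b c 0 q = if q = .tree then 1 else 0 := by
  classical
  have hpattern (H : SimpleGraph (Word 0)) :
      IsRootedForest (corner 0) q.rep H ↔ q = .tree := by
    have hreach (u v : Word 0) : H.Reachable u v := by rw [Subsingleton.elim u v]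
    rw [← Pattern.forall_rep_eq_iff]
    exact ⟨fun h j k => (h.reachable_iff j k).1 (hreach _ _), fun h =>
      ⟨.of_subsingleton, fun v => ⟨0, hreach _ _⟩, fun j k => iff_of_true (hreach _ _) (h j k)⟩⟩
  have hweight (H : SimpleGraph (Word 0)) : ∏ x ∈ H.edgeFinset, edgeWeight a b c 0 x = 1 := by
    refine Finset.prod_eq_one fun x hx => ?_
    rw [Subsingleton.elim H ⊥] at hx
    simp at hx
  simp only [genPattern, genFun, hpattern, hweight]
  split_ifs with h <;> simp [h, Subsingleton.elim _ (⊥ : SimpleGraph (Word 0))]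

end Transfer

section Evaluation

theorem sum_univ_eq_sum_vecCons {α M : Type*} [Fintype α] [AddCommMonoid M] {n : ℕ}
    (f : (Fin (n + 1) → α) → M) : ∑ p, f p = ∑ x, ∑ p, f (Matrix.vecCons x p) := by
  rw [← (Fin.consEquiv fun _ => α).sum_comp, Fintype.sum_prod_type]
  rfl

theorem sum_pattern {M : Type*} [AddCommMonoid M] (f : Pattern → M) :
    ∑ p, f p = f .tree + f (.isolated .a) + f (.isolated .b) + f (.isolated .c) + f .sep := by
  have huniv : (Finset.univ : Finset Pattern) =
      {.tree, .isolated .a, .isolated .b, .isolated .c, .sep} := by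
    decide
  simp [huniv, add_assoc]

variable {K : Type*} [CommRing K] (w : Gen → K) (F : Pattern → K)

theorem transfer_eq_sum_list (q : Pattern) :
    transfer w F q = ([[], [.c], [.b], [.b, .c], [.a], [.a, .c], [.a, .b], [.a, .b, .c]].map
      fun S => (S.map w).prod *
        ∑ x, ∑ y, ∑ z, if Joins q S ![x, y, z] then F x * F y * F z else 0).sum := by
  simp only [transfer, Finset.sum_filter, sum_univ_eq_sum_vecCons, Fin.prod_univ_three,
    Fintype.sum_unique]
  rfl

theorem transfer_tree :
    transfer w F .tree =
      F .tree ^ 3 * (w .a * w .b + w .a * w .c + w .b * w .c) +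
        2 * w .a * w .b * w .c * F .tree ^ 2 *
          (F (.isolated .b) + F (.isolated .a) + F (.isolated .c)) := by
  -- `decide` settles `Joins` for each of the `8 * 5 ^ 3` pairs of a set of bridges and a triple.
  simp (decide := true) only [transfer_eq_sum_list, sum_pattern, if_true, if_false, zero_add,
    add_zero, mul_zero, List.map_cons, List.map_nil, List.prod_cons, List.prod_nil, List.sum_cons,
    List.sum_nil]
  ring

theorem transfer_isolated_a :
    transfer w F (.isolated .a) =
      w .a * F .tree ^ 3 +
        F .tree ^ 2 * ((w .a * w .b + w .a * w .c + w .b * w .c) * F (.isolated .a) +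
          2 * w .a * (w .b * F (.isolated .b) + w .c * F (.isolated .c))) +
        w .a * w .b * w .c * F .tree * (3 * F (.isolated .b) * F (.isolated .c) +
          F (.isolated .a) *
            (F (.isolated .c) + F (.isolated .b) + 2 * F (.isolated .a))) +
        w .a * w .b * w .c * F .tree ^ 2 * F .sep := by
  simp (decide := true) only [transfer_eq_sum_list, sum_pattern, if_true, if_false, zero_add,
    add_zero, mul_zero, List.map_cons, List.map_nil, List.prod_cons, List.prod_nil, List.sum_cons,
    List.sum_nil]
  ring

theorem transfer_isolated_b :
    transfer w F (.isolated .b) =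
      w .b * F .tree ^ 3 +
        F .tree ^ 2 * ((w .a * w .b + w .a * w .c + w .b * w .c) * F (.isolated .b) +
          2 * w .b * (w .a * F (.isolated .a) + w .c * F (.isolated .c))) +
        w .a * w .b * w .c * F .tree * (3 * F (.isolated .a) * F (.isolated .c) +
          F (.isolated .b) *
            (F (.isolated .c) + F (.isolated .a) + 2 * F (.isolated .b))) +
        w .a * w .b * w .c * F .tree ^ 2 * F .sep := by
  simp (decide := true) only [transfer_eq_sum_list, sum_pattern, if_true, if_false, zero_add,
    add_zero, mul_zero, List.map_cons, List.map_nil, List.prod_cons, List.prod_nil, List.sum_cons,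
    List.sum_nil]
  ring

theorem transfer_isolated_c :
    transfer w F (.isolated .c) =
      w .c * F .tree ^ 3 +
        F .tree ^ 2 * ((w .a * w .b + w .a * w .c + w .b * w .c) * F (.isolated .c) +
          2 * w .c * (w .a * F (.isolated .a) + w .b * F (.isolated .b))) +
        w .a * w .b * w .c * F .tree * (3 * F (.isolated .a) * F (.isolated .b) +
          F (.isolated .c) *
            (F (.isolated .b) + F (.isolated .a) + 2 * F (.isolated .c))) +
        w .a * w .b * w .c * F .tree ^ 2 * F .sep := by
  simp (decide := true) only [transfer_eq_sum_list, sum_pattern, if_true, if_false, zero_add,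
    add_zero, mul_zero, List.map_cons, List.map_nil, List.prod_cons, List.prod_nil, List.sum_cons,
    List.sum_nil]
  ring

theorem transfer_sep :
    transfer w F .sep =
      4 * w .a * w .b * w .c * F .tree * F .sep *
          (F (.isolated .b) + F (.isolated .a) + F (.isolated .c)) +
        F .tree ^ 2 *
          ((2 * w .b + w .a + w .c) * F (.isolated .b) +
            (2 * w .a + w .b + w .c) * F (.isolated .a) +
            (2 * w .c + w .a + w .b) * F (.isolated .c)) +
        F .tree ^ 2 * F .sep * (w .a * w .b + w .a * w .c + w .b * w .c) +
        F .tree ^ 3 +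
        2 * w .a * w .b * w .c *
          (F (.isolated .b) ^ 2 * (F (.isolated .a) + F (.isolated .c)) +
            F (.isolated .a) ^ 2 * (F (.isolated .b) + F (.isolated .c)) +
            F (.isolated .c) ^ 2 * (F (.isolated .b) + F (.isolated .a)) +
            F (.isolated .b) * F (.isolated .a) * F (.isolated .c)) +
        2 * F .tree *
          (F (.isolated .b) * F (.isolated .a) * (w .a * w .c + w .b * w .c + 2 * w .a * w .b) +
            F (.isolated .b) * F (.isolated .c) * (w .a * w .b + w .a * w .c + 2 * w .b * w .c) +
            F (.isolated .a) * F (.isolated .c) * (w .a * w .b + w .b * w .c + 2 * w .a * w .c) +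
            w .b * F (.isolated .b) ^ 2 * (w .a + w .c) +
            w .a * F (.isolated .a) ^ 2 * (w .b + w .c) +
            w .c * F (.isolated .c) ^ 2 * (w .a + w .b)) := by
  simp (decide := true) only [transfer_eq_sum_list, sum_pattern, if_true, if_false, zero_add,
    add_zero, List.map_cons, List.map_nil, List.prod_cons, List.prod_nil, List.sum_cons,
    List.sum_nil]
  ring

end Evaluation

end Hanoi

theorem mainTheorem9 {K : Type*} [CommRing K] (a b c : K) (T U R L Q : ℕ → K)
    (hT : ∀ n, T n = Hanoi.genT a b c n)
    (hU : ∀ n, U n = Hanoi.genU a b c n)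
    (hR : ∀ n, R n = Hanoi.genR a b c n)
    (hL : ∀ n, L n = Hanoi.genL a b c n)
    (hQ : ∀ n, Q n = Hanoi.genQ a b c n) :
    (∀ n : ℕ, 1 ≤ n →
      T (n + 1) = T n ^ 3 * (a * b + a * c + b * c)
          + 2 * a * b * c * T n ^ 2 * (U n + R n + L n) ∧
      U (n + 1) = b * T n ^ 3
          + T n ^ 2 * ((a * b + a * c + b * c) * U n + 2 * b * (a * R n + c * L n))
          + a * b * c * T n * (3 * R n * L n + U n * (L n + R n + 2 * U n))
          + a * b * c * T n ^ 2 * Q n ∧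
      R (n + 1) = a * T n ^ 3
          + T n ^ 2 * ((a * b + a * c + b * c) * R n + 2 * a * (b * U n + c * L n))
          + a * b * c * T n * (3 * U n * L n + R n * (L n + U n + 2 * R n))
          + a * b * c * T n ^ 2 * Q n ∧
      L (n + 1) = c * T n ^ 3
          + T n ^ 2 * ((a * b + a * c + b * c) * L n + 2 * c * (a * R n + b * U n))
          + a * b * c * T n * (3 * R n * U n + L n * (U n + R n + 2 * L n))
          + a * b * c * T n ^ 2 * Q n ∧
      Q (n + 1) = 4 * a * b * c * T n * Q n * (U n + R n + L n)
          + T n ^ 2 * ((2 * b + a + c) * U n + (2 * a + b + c) * R n + (2 * c + a + b) * L n)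
          + T n ^ 2 * Q n * (a * b + a * c + b * c) + T n ^ 3
          + 2 * a * b * c * (U n ^ 2 * (R n + L n) + R n ^ 2 * (U n + L n)
              + L n ^ 2 * (U n + R n) + U n * R n * L n)
          + 2 * T n * (U n * R n * (a * c + b * c + 2 * a * b)
              + U n * L n * (a * b + a * c + 2 * b * c)
              + R n * L n * (a * b + b * c + 2 * a * c)
              + b * U n ^ 2 * (a + c) + a * R n ^ 2 * (b + c) + c * L n ^ 2 * (a + b))) ∧
    T 1 = a * b + a * c + b * c ∧ U 1 = b ∧ R 1 = a ∧ L 1 = c ∧ Q 1 = 1 := by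
  simp only [Hanoi.genT_eq_genPattern] at hT
  simp only [Hanoi.genU_eq_genPattern] at hU
  simp only [Hanoi.genR_eq_genPattern] at hR
  simp only [Hanoi.genL_eq_genPattern] at hL
  simp only [Hanoi.genQ_eq_genPattern] at hQ
  refine ⟨fun n _ => ?_, ?_⟩
  · simp only [hT, hU, hR, hL, hQ, Hanoi.genPattern_succ, Hanoi.transfer_tree,
      Hanoi.transfer_isolated_a, Hanoi.transfer_isolated_b, Hanoi.transfer_isolated_c,
      Hanoi.transfer_sep, Hanoi.labelWeight, and_self]
  · simp [hT, hU, hR, hL, hQ, Hanoi.genPattern_succ, Hanoi.genPattern_zero, Hanoi.transfer_tree,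
      Hanoi.transfer_isolated_a, Hanoi.transfer_isolated_b, Hanoi.transfer_isolated_c,
      Hanoi.transfer_sep, Hanoi.labelWeight]
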